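/- Let $K\ge 1$ and write $B(\mathbf C^n)$ for the complex $n\times n$ matrices; a state is a positive semidefinite matrix of trace one. For a matrix $A$ let $\|A\|_p=\big(\operatorname{Tr}(A^*A)^{p/2}\big)^{1/p}$, and for a positive linear map $\Phi$ let $\nu_p(\Phi)=\sup_\rho\|\Phi(\rho)\|_p$, the supremum over all input states $\rho$. For a completely positive trace-preserving (CPTP) map $\Phi$ define the Holevo capacity $$\chi^*(\Phi)=\sup_{\{\pi_i,\rho_i\}}\Big[S\Big(\sum_i\pi_i\Phi(\rho_i)\Big)-\sum_i\pi_i S(\Phi(\rho_i))\Big],\qquad S(\rho)=-\operatorname{Tr}\rho\log\rho,$$ the supremum over all finite ensembles of input states $\rho_i$ with probabilities $\pi_i$. Let $\Phi$ be a unital qubit channel, i.e. a CPTP map on $B(\mathbf C^2)$ with $\Phi(I)=I$. Suppose that for some real $s>1$, for all $p\in[1,s)$ and all positive semidefinite $2K\times 2K$ matrices $$M=\begin{pmatrix}X&Y\\ Y^*&Z\end{pmatrix}\in B(\mathbf C^K\otimes\mathbf C^2)$$ with $K\times K$ blocks $X,Y,Z$, one has $$\|(I\otimes\Phi)(M)\|_p\le\nu_p(\Phi)\,\big(\|X\|_p+\|Z\|_p\big).$$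 Then for every CPTP map $\Omega$ on $B(\mathbf C^K)$, $$\chi^*(\Omega\otimes\Phi)=\chi^*(\Omega)+\chi^*(\Phi).$$ -/

import Mathlib

open scoped Kronecker TensorProduct ComplexOrder

noncomputable section

namespace QubitChannel

/-- Linear maps on `B(ℂⁿ)`, written as `n × n` matrices. -/
abbrev MatrixMap (n : Type*) : Type _ := Matrix n n ℂ →ₗ[ℂ] Matrix n n ℂ

/-- The tensor product `Ω ⊗ Φ` of two maps, acting on `B(ℂᵐ ⊗ ℂⁿ)`. -/
def tensorMap {m n : Type*} [Fintype m] [Fintype n] [DecidableEq m] [DecidableEq n]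
    (Ω : MatrixMap m) (Φ : MatrixMap n) : MatrixMap (m × n) :=
  (kroneckerLinearEquiv m m n n ℂ).toLinearMap ∘ₗ TensorProduct.map Ω Φ ∘ₗ
    (kroneckerLinearEquiv m m n n ℂ).symm.toLinearMap

theorem tensorMap_kronecker {m n : Type*} [Fintype m] [Fintype n] [DecidableEq m] [DecidableEq n]
    (Ω : MatrixMap m) (Φ : MatrixMap n) (A : Matrix m m ℂ) (B : Matrix n n ℂ) :
    tensorMap Ω Φ (A ⊗ₖ B) = Ω A ⊗ₖ Φ B := by
  simp [tensorMap]

/-- `Φ` is completely positive: `I ⊗ Φ` is positive on `B(ℂᵏ ⊗ ℂⁿ)` for every `k`. -/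
def IsCompletelyPositive {n : Type*} [Fintype n] [DecidableEq n] (Φ : MatrixMap n) : Prop :=
  ∀ (k : ℕ) (M : Matrix (Fin k × n) (Fin k × n) ℂ), M.PosSemidef →
    (tensorMap (LinearMap.id : MatrixMap (Fin k)) Φ M).PosSemidef

/-- A channel: a completely positive trace-preserving map. -/
structure IsChannel {n : Type*} [Fintype n] [DecidableEq n] (Φ : MatrixMap n) : Prop where
  completelyPositive : IsCompletelyPositive Φ
  tracePreserving : ∀ A : Matrix n n ℂ, (Φ A).trace = A.trace

/-- States (density matrices): positive matrices of trace one. -/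
structure IsState {n : Type*} [Fintype n] (ρ : Matrix n n ℂ) : Prop where
  posSemidef : ρ.PosSemidef
  trace_eq_one : ρ.trace = 1

/-- The noncommutative `l_p` norm `‖A‖_p = (Tr (A* A)^{p/2})^{1/p}`. -/
def lpNorm {n : Type*} [Fintype n] [DecidableEq n] (p : ℝ) (A : Matrix n n ℂ) : ℝ :=
  ((cfc (fun x : ℝ => x ^ (p / 2)) (A.conjTranspose * A)).trace.re) ^ (1 / p)

/-- The maximal output `l_p` norm `ν_p(Φ) = sup_ρ ‖Φ(ρ)‖_p`, over all states `ρ`. -/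
def maxLpNorm {n : Type*} [Fintype n] [DecidableEq n] (p : ℝ) (Φ : MatrixMap n) : ℝ :=
  sSup {x : ℝ | ∃ ρ : Matrix n n ℂ, IsState ρ ∧ x = lpNorm p (Φ ρ)}

/-- The von Neumann entropy `S(ρ) = - Tr ρ log ρ` (natural logarithm, `0 log 0 = 0`). -/
def entropy {n : Type*} [Fintype n] [DecidableEq n] (ρ : Matrix n n ℂ) : ℝ :=
  -(ρ * cfc Real.log ρ).trace.re

/-- A finite ensemble `{π_i, ρ_i}` of states on `ℂⁿ`. -/
structure Ensemble (n : Type*) [Fintype n] where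
  /-- the number of states -/
  size : ℕ
  /-- the probabilities -/
  prob : Fin size → ℝ
  /-- the states -/
  state : Fin size → Matrix n n ℂ
  prob_mem : prob ∈ stdSimplex ℝ (Fin size)
  isState : ∀ i, IsState (state i)

/-- `χ(Φ; E) = S(∑ π_i Φ(ρ_i)) - ∑ π_i S(Φ(ρ_i))`. -/
def holevoQuantity {n : Type*} [Fintype n] [DecidableEq n] (Φ : MatrixMap n) (E : Ensemble n) : ℝ :=
  entropy (∑ i, (E.prob i : ℂ) • Φ (E.state i)) - ∑ i, E.prob i * entropy (Φ (E.state i))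

/-- The Holevo capacity `χ*(Φ) = sup_E χ(Φ; E)`. For a channel on `ℂⁿ` with `n` finite the
supremum is over a bounded set. -/
def holevoCapacity {n : Type*} [Fintype n] [DecidableEq n] (Φ : MatrixMap n) : ℝ :=
  ⨆ E : Ensemble n, holevoQuantity Φ E

/-- The `K × K` block in position `(a, b)` of a `2K × 2K` matrix. With
`M = [[X, Y], [Y*, Z]]`, the block `(0, 0)` is `X` and the block `(1, 1)` is `Z`. -/
def block {m : Type*} (M : Matrix (m × Fin 2) (m × Fin 2) ℂ) (a b : Fin 2) : Matrix m m ℂ :=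
  Matrix.of fun i j => M (i, a) (j, b)

end QubitChannel

end

open scoped Kronecker TensorProduct ComplexOrder

noncomputable section

namespace QubitChannel

open Matrix Real

variable {n m : Type*} [Fintype n] [DecidableEq n] [Fintype m] [DecidableEq m]

/-! Write `η(x) = -x log x`. Product ensembles give `≥`, since entropy is additive on product
states.

For `≤`, the norm inequality is tight at `p = 1` on states, so differentiating there
(`add_le_entropy_of_lpNorm_block_le`) yields, for every state `M` with diagonal blocks `X`, `Z`,
`S((I ⊗ Φ)M) ≥ S₀ + (S(X) - η(Tr X)) + (S(Z) - η(Tr Z))`, where `S₀` is any lower bound for the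
output entropy of `Φ`. Unitality allows `S₀ = log 2 - χ*(Φ)`
(`log_two_sub_entropy_le_holevoCapacity`).

Take `M = (Ω ⊗ I)(τ)` for each `τ` of an ensemble: the blocks of `M` are `Ω` of the blocks of `τ`.
The weighted blocks form an ensemble for `Ω` whose average is the averaged state with the qubit
traced out. Subadditivity bounds the entropy of the average output by that of its partial trace plus
`log 2`; the two `log 2` cancel and `χ*(Ω) + χ*(Φ)` remains. -/

/-! ### Entropy and p-norms as sums over eigenvalues -/

theorem isHermitian_conj_diagonal (U : Matrix n n ℂ) (d : n → ℝ) :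
    (U * diagonal (fun i => (d i : ℂ)) * star U).IsHermitian := by
  have h : (diagonal (fun i => (d i : ℂ))).IsHermitian := by
    ext i j
    by_cases hij : i = j
    · subst hij; simp
    · simp [hij, Ne.symm hij]
  exact isHermitian_mul_mul_conjTranspose U h

theorem exists_unitary_diagonal {A : Matrix n n ℂ} (hA : A.PosSemidef) :
    ∃ U ∈ unitaryGroup n ℂ, ∃ d : n → ℝ, (∀ i, 0 ≤ d i) ∧
      A = U * diagonal (fun i => (d i : ℂ)) * star U := by
  refine ⟨hA.1.eigenvectorUnitary, hA.1.eigenvectorUnitary.2, hA.1.eigenvalues,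
    hA.eigenvalues_nonneg, ?_⟩
  conv_lhs => rw [hA.1.spectral_theorem, Unitary.conjStarAlgAut_apply]
  rfl

theorem trace_conj_of_mem_unitaryGroup {U : Matrix n n ℂ} (hU : U ∈ unitaryGroup n ℂ)
    (D : Matrix n n ℂ) : (U * D * star U).trace = D.trace := by
  rw [trace_mul_comm, ← mul_assoc, mem_unitaryGroup_iff'.1 hU, one_mul]

theorem trace_conj_diagonal {U : Matrix n n ℂ} (hU : U ∈ unitaryGroup n ℂ) (d : n → ℝ) :
    (U * diagonal (fun i => (d i : ℂ)) * star U).trace = ((∑ i, d i : ℝ) : ℂ) := by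
  rw [trace_conj_of_mem_unitaryGroup hU, trace_diagonal]
  push_cast
  rfl

/-- The trace of the functional calculus, computed in any unitary diagonalization. -/
theorem trace_cfc_conj_diagonal {U : Matrix n n ℂ} (hU : U ∈ unitaryGroup n ℂ) (d : n → ℝ)
    (f : ℝ → ℝ) :
    (cfc f (U * diagonal (fun i => (d i : ℂ)) * star U)).trace.re = ∑ i, f (d i) := by
  have hH := isHermitian_conj_diagonal U d
  set A := U * diagonal (fun i => (d i : ℂ)) * star U with hA
  have h1 : (cfc f A).trace.re = ∑ i, f (hH.eigenvalues i) := by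
    rw [hH.cfc_eq, IsHermitian.cfc, Unitary.conjStarAlgAut_apply,
      trace_conj_of_mem_unitaryGroup hH.eigenvectorUnitary.2, trace_diagonal]
    simp
  -- The characteristic polynomial identifies `d` with Mathlib's eigenvalues as multisets, which
  -- suffices for a symmetric sum.
  have h2 : A.charpoly = ∏ i, (Polynomial.X - Polynomial.C (d i : ℂ)) := by
    rw [hA, charpoly_mul_comm, ← mul_assoc, mem_unitaryGroup_iff'.1 hU, one_mul,
      charpoly_diagonal]
  have h3 : Multiset.map (fun i => (hH.eigenvalues i : ℂ)) Finset.univ.val =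
      Multiset.map (fun i => (d i : ℂ)) Finset.univ.val := by
    rw [← Polynomial.roots_multiset_prod_X_sub_C (Multiset.map (fun i => (d i : ℂ)) _),
      Multiset.map_map]
    have := hH.roots_charpoly_eq_eigenvalues
    rw [h2] at this
    exact this.symm
  have h4 := congrArg (fun s => (s.map (fun z : ℂ => f z.re)).sum) h3
  simp only [Multiset.map_map, Function.comp_def, Complex.ofReal_re] at h4
  rw [h1]
  exact h4

theorem entropy_conj_diagonal {U : Matrix n n ℂ} (hU : U ∈ unitaryGroup n ℂ) (d : n → ℝ) :
    entropy (U * diagonal (fun i => (d i : ℂ)) * star U) = ∑ i, negMulLog (d i) := by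
  have hH := isHermitian_conj_diagonal U d
  have hs : IsSelfAdjoint (U * diagonal (fun i => (d i : ℂ)) * star U) := hH
  have key : (U * diagonal (fun i => (d i : ℂ)) * star U) *
      cfc Real.log (U * diagonal (fun i => (d i : ℂ)) * star U) =
      cfc (fun x => x * Real.log x) (U * diagonal (fun i => (d i : ℂ)) * star U) := by
    rw [cfc_mul (fun x : ℝ => x) Real.log _ (by fun_prop)
      (finite_real_spectrum.continuousOn _), cfc_id' ℝ _ hs]
  rw [entropy, key, trace_cfc_conj_diagonal hU, ← Finset.sum_neg_distrib]
  simp [negMulLog]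

theorem lpNorm_conj_diagonal {U : Matrix n n ℂ} (hU : U ∈ unitaryGroup n ℂ) {d : n → ℝ}
    (hd : ∀ i, 0 ≤ d i) (p : ℝ) :
    lpNorm p (U * diagonal (fun i => (d i : ℂ)) * star U) = (∑ i, d i ^ p) ^ (1 / p) := by
  have hH := isHermitian_conj_diagonal U d
  have h : (U * diagonal (fun i => (d i : ℂ)) * star U).conjTranspose *
      (U * diagonal (fun i => (d i : ℂ)) * star U) =
      U * diagonal (fun i => ((d i ^ 2 : ℝ) : ℂ)) * star U := by
    rw [hH.eq]
    calc _ = U * (diagonal (fun i => (d i : ℂ)) * (star U * U) * diagonal (fun i => (d i : ℂ))) *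
          star U := by simp only [mul_assoc]
      _ = _ := by
        rw [mem_unitaryGroup_iff'.1 hU, mul_one, diagonal_mul_diagonal]
        simp [sq]
  rw [lpNorm, h, trace_cfc_conj_diagonal hU]
  congr 2
  ext i
  rw [← Real.rpow_natCast, ← Real.rpow_mul (hd i)]
  congr 1
  push_cast
  ring

theorem entropy_smul {A : Matrix n n ℂ} (hA : A.PosSemidef) (c : ℝ) :
    entropy ((c : ℂ) • A) = c * entropy A + negMulLog c * A.trace.re := by
  obtain ⟨U, hU, d, -, rfl⟩ := exists_unitary_diagonal hA
  have : (c : ℂ) • (U * diagonal (fun i => (d i : ℂ)) * star U) =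
      U * diagonal (fun i => ((c * d i : ℝ) : ℂ)) * star U := by
    rw [← smul_mul_assoc, ← mul_smul_comm, ← diagonal_smul]
    congr 3
    ext i
    simp
  rw [this, entropy_conj_diagonal hU, entropy_conj_diagonal hU, trace_conj_diagonal hU,
    Complex.ofReal_re, Finset.mul_sum, Finset.mul_sum, ← Finset.sum_add_distrib]
  refine Finset.sum_congr rfl fun i _ => ?_
  rw [negMulLog_mul]
  ring

@[simp] theorem entropy_zero : entropy (0 : Matrix n n ℂ) = 0 := by simp [entropy]

omit [DecidableEq n] in
theorem eigenvalue_le_one {d : n → ℝ} (hd : ∀ i, 0 ≤ d i) (h : ∑ i, d i = 1) (i : n) :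
    d i ≤ 1 :=
  h ▸ Finset.single_le_sum (fun j _ => hd j) (Finset.mem_univ i)

theorem entropy_nonneg {ρ : Matrix n n ℂ} (hρ : IsState ρ) : 0 ≤ entropy ρ := by
  obtain ⟨U, hU, d, hd, rfl⟩ := exists_unitary_diagonal hρ.posSemidef
  have ht := hρ.trace_eq_one
  rw [trace_conj_diagonal hU] at ht
  rw [entropy_conj_diagonal hU]
  exact Finset.sum_nonneg fun i _ =>
    negMulLog_nonneg (hd i) (eigenvalue_le_one hd (by exact_mod_cast ht) i)

/-- Crude, from `η(x) ≤ 1 - x`; it serves only to make the capacity supremum finite. -/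
theorem entropy_le_card {A : Matrix n n ℂ} (hA : A.PosSemidef) :
    entropy A ≤ Fintype.card n := by
  obtain ⟨U, hU, d, hd, rfl⟩ := exists_unitary_diagonal hA
  rw [entropy_conj_diagonal hU]
  calc ∑ i, negMulLog (d i) ≤ ∑ _i : n, (1 : ℝ) :=
        Finset.sum_le_sum fun i _ => by linarith [negMulLog_le_one_sub_self (hd i), hd i]
    _ = _ := by simp

/-! ### Entropy inequalities and product states -/

theorem sum_normSq_row {W : Matrix n n ℂ} (hW : W ∈ unitaryGroup n ℂ) (i : n) :
    ∑ j, Complex.normSq (W i j) = 1 := by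
  have h := congrFun (congrFun (mem_unitaryGroup_iff.1 hW) i) i
  rw [mul_apply, one_apply_eq] at h
  have h' := congrArg Complex.re h
  simpa [Complex.mul_conj] using h'

theorem sum_normSq_col {W : Matrix n n ℂ} (hW : W ∈ unitaryGroup n ℂ) (j : n) :
    ∑ i, Complex.normSq (W i j) = 1 := by
  simpa using sum_normSq_row (Unitary.star_mem hW) j

/-- Peierls-type inequality: the entropy is at most that of the diagonal in any
orthonormal basis. -/
theorem entropy_le_sum_negMulLog_diag {A : Matrix n n ℂ} (hA : A.PosSemidef) {V : Matrix n n ℂ}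
    (hV : V ∈ unitaryGroup n ℂ) :
    entropy A ≤ ∑ i, negMulLog ((star V * A * V) i i).re := by
  obtain ⟨U, hU, d, hd, rfl⟩ := exists_unitary_diagonal hA
  -- The squared moduli of the entries of `W` form a doubly stochastic matrix: rows feed Jensen,
  -- columns restore the eigenvalue sum.
  set W := star V * U with hWdef
  have hW : W ∈ unitaryGroup n ℂ := mul_mem (Unitary.star_mem hV) hU
  have hB : star V * (U * diagonal (fun i => (d i : ℂ)) * star U) * V =
      W * diagonal (fun i => (d i : ℂ)) * star W := by
    simp only [hWdef, star_mul, star_star, mul_assoc]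
  have hdiag : ∀ i, ((star V * (U * diagonal (fun i => (d i : ℂ)) * star U) * V) i i).re =
      ∑ j, Complex.normSq (W i j) * d j := by
    intro i
    rw [hB, mul_apply, Complex.re_sum]
    refine Finset.sum_congr rfl fun j _ => ?_
    rw [mul_diagonal, star_apply, mul_right_comm, RCLike.star_def, Complex.mul_conj,
      ← Complex.ofReal_mul, Complex.ofReal_re]
  rw [entropy_conj_diagonal hU]
  calc ∑ j, negMulLog (d j) = ∑ j, ∑ i, Complex.normSq (W i j) * negMulLog (d j) := by
        refine Finset.sum_congr rfl fun j _ => ?_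
        rw [← Finset.sum_mul, sum_normSq_col hW, one_mul]
    _ = ∑ i, ∑ j, Complex.normSq (W i j) * negMulLog (d j) := Finset.sum_comm
    _ ≤ _ := by
        refine Finset.sum_le_sum fun i _ => ?_
        rw [hdiag]
        simpa using concaveOn_negMulLog.le_map_sum (t := Finset.univ)
          (w := fun j => Complex.normSq (W i j)) (p := d)
          (fun j _ => Complex.normSq_nonneg _) (sum_normSq_row hW i) (fun j _ => hd j)

theorem kronecker_mem_unitaryGroup {U : Matrix m m ℂ} {V : Matrix n n ℂ}
    (hU : U ∈ unitaryGroup m ℂ) (hV : V ∈ unitaryGroup n ℂ) :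
    U ⊗ₖ V ∈ unitaryGroup (m × n) ℂ := by
  rw [mem_unitaryGroup_iff, star_eq_conjTranspose, conjTranspose_kronecker, ← mul_kronecker_mul,
    ← star_eq_conjTranspose, ← star_eq_conjTranspose, mem_unitaryGroup_iff.1 hU,
    mem_unitaryGroup_iff.1 hV, one_kronecker_one]

theorem entropy_kronecker {A : Matrix m m ℂ} {B : Matrix n n ℂ} (hA : IsState A)
    (hB : IsState B) : entropy (A ⊗ₖ B) = entropy A + entropy B := by
  obtain ⟨U, hU, d, -, rfl⟩ := exists_unitary_diagonal hA.posSemidef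
  obtain ⟨V, hV, e, -, rfl⟩ := exists_unitary_diagonal hB.posSemidef
  have hd := hA.trace_eq_one
  have he := hB.trace_eq_one
  rw [trace_conj_diagonal hU] at hd
  rw [trace_conj_diagonal hV] at he
  replace hd : ∑ i, d i = 1 := by exact_mod_cast hd
  replace he : ∑ i, e i = 1 := by exact_mod_cast he
  have h : (U * diagonal (fun i => (d i : ℂ)) * star U) ⊗ₖ
      (V * diagonal (fun i => (e i : ℂ)) * star V) =
      (U ⊗ₖ V) * diagonal (fun i : m × n => ((d i.1 * e i.2 : ℝ) : ℂ)) * star (U ⊗ₖ V) := by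
    rw [mul_kronecker_mul, mul_kronecker_mul, diagonal_kronecker_diagonal,
      star_eq_conjTranspose (U ⊗ₖ V), conjTranspose_kronecker]
    simp [star_eq_conjTranspose]
  rw [h, entropy_conj_diagonal (kronecker_mem_unitaryGroup hU hV), entropy_conj_diagonal hU,
    entropy_conj_diagonal hV, Fintype.sum_prod_type]
  simp only [negMulLog_mul, Finset.sum_add_distrib, ← Finset.mul_sum, ← Finset.sum_mul, hd, he,
    one_mul]

/-- Midpoint concavity of `η`: splitting a weight in two gains at most one bit. -/
theorem negMulLog_add_le_negMulLog_add {x y : ℝ} (hx : 0 ≤ x) (hy : 0 ≤ y) :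
    negMulLog x + negMulLog y ≤ negMulLog (x + y) + (x + y) * Real.log 2 := by
  have h := concaveOn_negMulLog.2 (Set.mem_Ici.2 hx) (Set.mem_Ici.2 hy)
    (show (0 : ℝ) ≤ 1 / 2 by norm_num) (show (0 : ℝ) ≤ 1 / 2 by norm_num) (by norm_num)
  have h2 : negMulLog (1 / 2) = 1 / 2 * Real.log 2 := by
    simp [negMulLog, Real.log_inv]
  simp only [smul_eq_mul] at h
  rw [← mul_add, ← mul_add, negMulLog_mul, h2] at h
  linarith

omit [Fintype m] [DecidableEq m] in
theorem posSemidef_block {M : Matrix (m × Fin 2) (m × Fin 2) ℂ} (hM : M.PosSemidef) (a : Fin 2) :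
    (block M a a).PosSemidef :=
  hM.submatrix fun i => (i, a)

/-- Subadditivity of the entropy, with the trivial bound `log 2` for the qubit. -/
theorem entropy_le_entropy_partialTrace_add_log_two {M : Matrix (m × Fin 2) (m × Fin 2) ℂ}
    (hM : IsState M) : entropy M ≤ entropy (block M 0 0 + block M 1 1) + Real.log 2 := by
  have hP := (posSemidef_block hM.posSemidef 0).add (posSemidef_block hM.posSemidef 1)
  obtain ⟨U, hU, d, hd, hUd⟩ := exists_unitary_diagonal hP
  -- Basis for the Peierls inequality: eigenvectors of the partial trace tensored with the standard
  -- qubit basis. Each eigenvalue `d i` then splits into two diagonal entries.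
  have hV := kronecker_mem_unitaryGroup hU (one_mem (unitaryGroup (Fin 2) ℂ))
  have hentry : ∀ (i : m) (a : Fin 2),
      (star (U ⊗ₖ (1 : Matrix (Fin 2) (Fin 2) ℂ)) * M *
        (U ⊗ₖ (1 : Matrix (Fin 2) (Fin 2) ℂ)) : Matrix _ _ ℂ) (i, a) (i, a) =
      (star U * block M a a * U) i i := by
    intro i a
    simp only [mul_apply, star_apply, kroneckerMap_apply, Fintype.sum_prod_type, block, of_apply]
    fin_cases a <;> simp [Matrix.one_apply]
  have hsum : ∀ i, ((star U * block M 0 0 * U) i i).re + ((star U * block M 1 1 * U) i i).re =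
      d i := by
    intro i
    rw [← Complex.add_re, ← Matrix.add_apply, ← add_mul, ← mul_add, hUd]
    have : star U * (U * diagonal (fun i => (d i : ℂ)) * star U) * U =
        (star U * U) * diagonal (fun i => (d i : ℂ)) * (star U * U) := by
      simp only [mul_assoc]
    rw [this, mem_unitaryGroup_iff'.1 hU]
    simp
  have hnn : ∀ (a : Fin 2) (i : m), 0 ≤ ((star U * block M a a * U) i i).re := fun a i =>
    (Complex.le_def.1 ((posSemidef_block hM.posSemidef a).conjTranspose_mul_mul_same U).diag_nonneg
      ).1
  have htr : ∑ i, d i = 1 := by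
    have h := trace_conj_diagonal hU d
    rw [← hUd, trace_add] at h
    have h2 := hM.trace_eq_one
    simp only [Matrix.trace, Matrix.diag_apply, Fintype.sum_prod_type, Fin.sum_univ_two,
      Finset.sum_add_distrib] at h2
    have h3 : (block M 0 0).trace + (block M 1 1).trace = 1 := h2
    rw [h3] at h
    exact_mod_cast h.symm
  refine (entropy_le_sum_negMulLog_diag hM.posSemidef hV).trans ?_
  rw [hUd, entropy_conj_diagonal hU, Fintype.sum_prod_type]
  simp only [hentry, Fin.sum_univ_two]
  calc _ ≤ ∑ i, (negMulLog (d i) + d i * Real.log 2) :=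
        Finset.sum_le_sum fun i _ => by
          rw [← hsum i]
          exact negMulLog_add_le_negMulLog_add (hnn 0 i) (hnn 1 i)
    _ = _ := by rw [Finset.sum_add_distrib, ← Finset.sum_mul, htr, one_mul]

/-! ### Antipodal qubit states -/

theorem one_sub_conj_diagonal {U : Matrix n n ℂ} (hU : U ∈ unitaryGroup n ℂ) (d : n → ℝ) :
    1 - U * diagonal (fun i => (d i : ℂ)) * star U =
      U * diagonal (fun i => ((1 - d i : ℝ) : ℂ)) * star U := by
  have hD : diagonal (fun i => ((1 - d i : ℝ) : ℂ)) = 1 - diagonal (fun i => (d i : ℂ)) := by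
    rw [← diagonal_one, diagonal_sub]
    push_cast
    rfl
  rw [hD, mul_sub, sub_mul, mul_one, mem_unitaryGroup_iff.1 hU]

/-- The antipodal qubit state has the same entropy. -/
theorem entropy_one_sub {ρ : Matrix (Fin 2) (Fin 2) ℂ} (hρ : IsState ρ) :
    entropy (1 - ρ) = entropy ρ := by
  obtain ⟨U, hU, d, -, rfl⟩ := exists_unitary_diagonal hρ.posSemidef
  have ht := hρ.trace_eq_one
  rw [trace_conj_diagonal hU] at ht
  replace ht : ∑ i, d i = 1 := by exact_mod_cast ht
  rw [Fin.sum_univ_two] at ht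
  rw [one_sub_conj_diagonal hU, entropy_conj_diagonal hU, entropy_conj_diagonal hU,
    Fin.sum_univ_two,
    Fin.sum_univ_two, show 1 - d 0 = d 1 by linarith, show 1 - d 1 = d 0 by linarith, add_comm]

theorem isState_one_sub {ρ : Matrix (Fin 2) (Fin 2) ℂ} (hρ : IsState ρ) :
    IsState (1 - ρ) := by
  refine ⟨?_, by rw [trace_sub, hρ.trace_eq_one]; simp; norm_num⟩
  obtain ⟨U, hU, d, hd, rfl⟩ := exists_unitary_diagonal hρ.posSemidef
  have ht := hρ.trace_eq_one
  rw [trace_conj_diagonal hU] at ht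
  replace ht : ∑ i, d i = 1 := by exact_mod_cast ht
  rw [one_sub_conj_diagonal hU]
  refine PosSemidef.mul_mul_conjTranspose_same (.diagonal fun i => ?_) U
  exact Complex.zero_le_real.2 (sub_nonneg.2 (eigenvalue_le_one hd ht i))

theorem entropy_half_one :
    entropy ((1 / 2 : ℂ) • (1 : Matrix (Fin 2) (Fin 2) ℂ)) = Real.log 2 := by
  have h := entropy_conj_diagonal (one_mem (unitaryGroup (Fin 2) ℂ)) (fun _ => 1 / 2)
  have h2 : negMulLog (1 / 2) = 1 / 2 * Real.log 2 := by
    simp [negMulLog, Real.log_inv]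
  rw [Fin.sum_univ_two, h2] at h
  rw [smul_one_eq_diagonal]
  simp only [star_one, mul_one, one_mul] at h
  push_cast at h
  rw [h]
  ring

/-! ### Tensor products of maps, blocks and partial traces -/

theorem linearMap_ext_kronecker {V : Type*} [AddCommMonoid V] [Module ℂ V]
    {f g : Matrix (m × n) (m × n) ℂ →ₗ[ℂ] V}
    (h : ∀ (A : Matrix m m ℂ) (B : Matrix n n ℂ), f (A ⊗ₖ B) = g (A ⊗ₖ B)) : f = g := by
  have hc : f ∘ₗ (kroneckerLinearEquiv m m n n ℂ).toLinearMap =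
      g ∘ₗ (kroneckerLinearEquiv m m n n ℂ).toLinearMap :=
    TensorProduct.ext' fun A B => by simpa using h A B
  ext1 M
  obtain ⟨T, rfl⟩ := (kroneckerLinearEquiv m m n n ℂ).surjective M
  exact LinearMap.congr_fun hc T

theorem trace_tensorMap {Ω : MatrixMap m} {Φ : MatrixMap n} (hΩ : ∀ A, (Ω A).trace = A.trace)
    (hΦ : ∀ A, (Φ A).trace = A.trace) (M : Matrix (m × n) (m × n) ℂ) :
    (tensorMap Ω Φ M).trace = M.trace := by
  have h : traceLinearMap (m × n) ℂ ℂ ∘ₗ tensorMap Ω Φ = traceLinearMap (m × n) ℂ ℂ :=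
    linearMap_ext_kronecker fun A B => by
      simp [tensorMap_kronecker, trace_kronecker, hΩ, hΦ]
  exact LinearMap.congr_fun h M

theorem tensorMap_id_left_tensorMap_id_right (Ω : MatrixMap m) (Φ : MatrixMap n)
    (M : Matrix (m × n) (m × n) ℂ) :
    tensorMap LinearMap.id Φ (tensorMap Ω LinearMap.id M) = tensorMap Ω Φ M := by
  have h : tensorMap LinearMap.id Φ ∘ₗ tensorMap Ω LinearMap.id = tensorMap Ω Φ :=
    linearMap_ext_kronecker fun A B => by simp [tensorMap_kronecker]
  exact LinearMap.congr_fun h M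

theorem tensorMap_submatrix_swap (Ω : MatrixMap m) (Φ : MatrixMap n)
    (M : Matrix (m × n) (m × n) ℂ) :
    (tensorMap Φ Ω (M.submatrix Prod.swap Prod.swap)).submatrix Prod.swap Prod.swap =
      tensorMap Ω Φ M := by
  have h : (reindexLinearEquiv ℂ ℂ (Equiv.prodComm n m) (Equiv.prodComm n m)).toLinearMap ∘ₗ
      tensorMap Φ Ω ∘ₗ
      (reindexLinearEquiv ℂ ℂ (Equiv.prodComm m n) (Equiv.prodComm m n)).toLinearMap =
      tensorMap Ω Φ :=
    linearMap_ext_kronecker fun A B => by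
      have e1 : (reindexLinearEquiv ℂ ℂ (Equiv.prodComm m n) (Equiv.prodComm m n)) (A ⊗ₖ B) =
          B ⊗ₖ A := by
        ext i j
        simp [mul_comm]
      have e2 : (reindexLinearEquiv ℂ ℂ (Equiv.prodComm n m) (Equiv.prodComm n m))
          (Φ B ⊗ₖ Ω A) = Ω A ⊗ₖ Φ B := by
        ext i j
        simp [mul_comm]
      simp only [LinearMap.comp_apply, LinearEquiv.coe_coe, e1, tensorMap_kronecker, e2]
  exact LinearMap.congr_fun h M

theorem IsCompletelyPositive.posSemidef {Φ : MatrixMap n} (hΦ : IsCompletelyPositive Φ)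
    {A : Matrix n n ℂ} (hA : A.PosSemidef) : (Φ A).PosSemidef := by
  have h := hΦ 1 _ ((PosSemidef.one (n := Fin 1) (R := ℂ)).kronecker hA)
  rw [tensorMap_kronecker] at h
  convert h.submatrix (fun i => ((0 : Fin 1), i)) using 1
  ext i j
  simp

theorem IsChannel.isState {Φ : MatrixMap n} (hΦ : IsChannel Φ) {ρ : Matrix n n ℂ}
    (hρ : IsState ρ) : IsState (Φ ρ) :=
  ⟨hΦ.completelyPositive.posSemidef hρ.posSemidef, by
    rw [hΦ.tracePreserving, hρ.trace_eq_one]⟩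

/-- Complete positivity is defined with the ancilla on the left; swapping the factors moves it to
the right. -/
theorem IsCompletelyPositive.tensorMap_id {k l : ℕ} {Ω : MatrixMap (Fin k)}
    (hΩ : IsCompletelyPositive Ω) {M : Matrix (Fin k × Fin l) (Fin k × Fin l) ℂ}
    (hM : M.PosSemidef) : (tensorMap Ω LinearMap.id M).PosSemidef := by
  rw [← tensorMap_submatrix_swap]
  exact (hΩ l _ (hM.submatrix Prod.swap)).submatrix Prod.swap

theorem IsChannel.isState_tensorMap {k l : ℕ} {Ω : MatrixMap (Fin k)} {Φ : MatrixMap (Fin l)}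
    (hΩ : IsChannel Ω) (hΦ : IsChannel Φ) {τ : Matrix (Fin k × Fin l) (Fin k × Fin l) ℂ}
    (hτ : IsState τ) : IsState (tensorMap Ω Φ τ) := by
  refine ⟨?_, by
    rw [trace_tensorMap hΩ.tracePreserving hΦ.tracePreserving, hτ.trace_eq_one]⟩
  rw [← tensorMap_id_left_tensorMap_id_right]
  exact hΦ.completelyPositive k _ (hΩ.completelyPositive.tensorMap_id hτ.posSemidef)

/-- `block` as a linear map. -/
def blockLinearMap (a b : Fin 2) :
    Matrix (m × Fin 2) (m × Fin 2) ℂ →ₗ[ℂ] Matrix m m ℂ where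
  toFun M := block M a b
  map_add' _ _ := rfl
  map_smul' _ _ := rfl

omit [Fintype m] [DecidableEq m] in
theorem blockLinearMap_kronecker (A : Matrix m m ℂ) (B : Matrix (Fin 2) (Fin 2) ℂ)
    (a b : Fin 2) : blockLinearMap a b (A ⊗ₖ B) = B a b • A := by
  ext i j
  simp [blockLinearMap, block, mul_comm]

theorem block_tensorMap_id (Ω : MatrixMap m) (M : Matrix (m × Fin 2) (m × Fin 2) ℂ)
    (a b : Fin 2) : block (tensorMap Ω LinearMap.id M) a b = Ω (block M a b) := by
  have h : blockLinearMap a b ∘ₗ tensorMap Ω LinearMap.id = Ω ∘ₗ blockLinearMap a b :=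
    linearMap_ext_kronecker fun A B => by
      simp [tensorMap_kronecker, blockLinearMap_kronecker]
  exact LinearMap.congr_fun h M

theorem partialTrace_tensorMap (Ω : MatrixMap m) {Φ : MatrixMap (Fin 2)}
    (hΦ : ∀ A, (Φ A).trace = A.trace) (M : Matrix (m × Fin 2) (m × Fin 2) ℂ) :
    block (tensorMap Ω Φ M) 0 0 + block (tensorMap Ω Φ M) 1 1 =
      Ω (block M 0 0 + block M 1 1) := by
  have h : (blockLinearMap 0 0 + blockLinearMap 1 1) ∘ₗ tensorMap Ω Φ =
      Ω ∘ₗ (blockLinearMap 0 0 + blockLinearMap 1 1) :=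
    linearMap_ext_kronecker fun A B => by
      have hB := hΦ B
      simp only [trace_fin_two] at hB
      simp [tensorMap_kronecker, blockLinearMap_kronecker, ← add_smul, hB]
  exact LinearMap.congr_fun h M

omit [DecidableEq m] in
theorem trace_block_add (M : Matrix (m × Fin 2) (m × Fin 2) ℂ) :
    (block M 0 0).trace + (block M 1 1).trace = M.trace := by
  simp [Matrix.trace, block, Fintype.sum_prod_type, Finset.sum_add_distrib]

/-! ### Ensembles and the Holevo capacity -/

theorem exists_isState [Nonempty n] : ∃ ρ : Matrix n n ℂ, IsState ρ := by
  obtain ⟨i⟩ := ‹Nonempty n›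
  refine ⟨diagonal (Pi.single i 1), .diagonal (Pi.single_nonneg.2 zero_le_one), ?_⟩
  simp [trace_diagonal]

omit [DecidableEq n] in
theorem posSemidef_ofReal_trace {A : Matrix n n ℂ} (hA : A.PosSemidef) :
    0 ≤ A.trace.re ∧ ((A.trace.re : ℝ) : ℂ) = A.trace := by
  have h := Complex.le_def.1 hA.trace_nonneg
  exact ⟨h.1, Complex.ext (by simp) (by simpa using h.2)⟩

theorem exists_isState_smul_eq [Nonempty n] {A : Matrix n n ℂ} (hA : A.PosSemidef) :
    ∃ ρ : Matrix n n ℂ, IsState ρ ∧ A = ((A.trace.re : ℝ) : ℂ) • ρ := by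
  obtain ⟨h0, ht⟩ := posSemidef_ofReal_trace hA
  rcases h0.eq_or_lt with h | h
  · obtain ⟨ρ, hρ⟩ := exists_isState (n := n)
    refine ⟨ρ, hρ, ?_⟩
    rw [← h] at ht ⊢
    have : A = 0 := hA.trace_eq_zero_iff.1 (by rw [← ht]; simp)
    simp [this]
  · have hne : ((A.trace.re : ℝ) : ℂ) ≠ 0 := by exact_mod_cast h.ne'
    refine ⟨((A.trace.re : ℝ) : ℂ)⁻¹ • A, ⟨hA.smul ?_, ?_⟩, ?_⟩
    · rw [← Complex.ofReal_inv]
      exact Complex.zero_le_real.2 (inv_nonneg.2 h0)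
    · rw [trace_smul, smul_eq_mul]
      conv_lhs => rw [← ht]
      simpa using inv_mul_cancel₀ hne
    · rw [smul_smul, mul_inv_cancel₀ hne, one_smul]

omit [DecidableEq n] in
theorem isState_sum {ι : Type*} [Fintype ι] {w : ι → ℝ} (hw : w ∈ stdSimplex ℝ ι)
    {ρ : ι → Matrix n n ℂ} (hρ : ∀ i, IsState (ρ i)) : IsState (∑ i, (w i : ℂ) • ρ i) := by
  refine ⟨posSemidef_sum _ fun i _ => (hρ i).posSemidef.smul (Complex.zero_le_real.2 (hw.1 i)), ?_⟩
  simp only [trace_sum, trace_smul, (hρ _).trace_eq_one, smul_eq_mul, mul_one]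
  exact_mod_cast hw.2

/-- An unbounded real supremum defaults to `0`, so bounding an ensemble by the capacity needs this.
-/
theorem bddAbove_holevoQuantity {Φ : MatrixMap n} (hΦ : ∀ ρ, IsState ρ → IsState (Φ ρ)) :
    BddAbove (Set.range (holevoQuantity Φ)) := by
  refine ⟨Fintype.card n, ?_⟩
  rintro - ⟨E, rfl⟩
  have h1 := entropy_le_card (isState_sum E.prob_mem fun i => hΦ _ (E.isState i)).posSemidef
  have h2 : 0 ≤ ∑ i, E.prob i * entropy (Φ (E.state i)) :=
    Finset.sum_nonneg fun i _ => mul_nonneg (E.prob_mem.1 i) (entropy_nonneg (hΦ _ (E.isState i)))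
  rw [holevoQuantity]
  linarith

theorem holevo_le_holevoCapacity {Φ : MatrixMap n} (hΦ : ∀ ρ, IsState ρ → IsState (Φ ρ))
    {ι : Type*} [Fintype ι] {w : ι → ℝ} (hw : w ∈ stdSimplex ℝ ι)
    {ρ : ι → Matrix n n ℂ} (hρ : ∀ i, IsState (ρ i)) :
    entropy (∑ i, (w i : ℂ) • Φ (ρ i)) - ∑ i, w i * entropy (Φ (ρ i)) ≤ holevoCapacity Φ := by
  let e := (Fintype.equivFin ι).symm
  let E : Ensemble n :=
    { size := Fintype.card ι
      prob := w ∘ e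
      state := ρ ∘ e
      prob_mem := ⟨fun i => hw.1 _, by rw [← hw.2]; exact e.sum_comp w⟩
      isState := fun i => hρ _ }
  have h := le_ciSup (bddAbove_holevoQuantity hΦ) E
  have h1 := e.sum_comp fun i => (w i : ℂ) • Φ (ρ i)
  have h2 := e.sum_comp fun i => w i * entropy (Φ (ρ i))
  rw [← h1, ← h2]
  exact h

/-- The Holevo bound for an ensemble given by unnormalized states. -/
theorem holevo_le_holevoCapacity_of_posSemidef [Nonempty n] {Φ : MatrixMap n}
    (hΦ : ∀ ρ, IsState ρ → IsState (Φ ρ)) {ι : Type*} [Fintype ι] {T : ι → Matrix n n ℂ}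
    (hT : ∀ i, (T i).PosSemidef) (htr : ∑ i, (T i).trace.re = 1) :
    entropy (Φ (∑ i, T i)) - ∑ i, (entropy (Φ (T i)) - negMulLog (T i).trace.re) ≤
      holevoCapacity Φ := by
  choose ρ hρ hTρ using fun i => exists_isState_smul_eq (hT i)
  have h := holevo_le_holevoCapacity hΦ (w := fun i => (T i).trace.re)
    ⟨fun i => (posSemidef_ofReal_trace (hT i)).1, htr⟩ hρ
  have h1 : ∀ i, (((T i).trace.re : ℝ) : ℂ) • Φ (ρ i) = Φ (T i) := fun i => by
    rw [← map_smul, ← hTρ]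
  have h2 : ∀ i, entropy (Φ (T i)) - negMulLog (T i).trace.re =
      (T i).trace.re * entropy (Φ (ρ i)) := fun i => by
    rw [← h1, entropy_smul (hΦ _ (hρ i)).posSemidef, (hΦ _ (hρ i)).trace_eq_one]
    simp
  simp only [h2, map_sum]
  simpa only [h1] using h

theorem nonempty_ensemble [Nonempty n] : Nonempty (Ensemble n) := by
  obtain ⟨ρ, hρ⟩ := exists_isState (n := n)
  exact ⟨⟨1, fun _ => 1, fun _ => ρ, ⟨fun _ => zero_le_one, by simp⟩, fun _ => hρ⟩⟩

omit [DecidableEq n] [DecidableEq m] in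
theorem isState_kronecker {A : Matrix m m ℂ} {B : Matrix n n ℂ} (hA : IsState A)
    (hB : IsState B) : IsState (A ⊗ₖ B) :=
  ⟨hA.posSemidef.kronecker hB.posSemidef, by
    rw [trace_kronecker, hA.trace_eq_one, hB.trace_eq_one, one_mul]⟩

/-- Superadditivity of the Holevo capacity, from product ensembles. -/
theorem holevoCapacity_add_le [Nonempty m] [Nonempty n] {Ω : MatrixMap m} {Φ : MatrixMap n}
    (hΩ : ∀ ρ, IsState ρ → IsState (Ω ρ)) (hΦ : ∀ ρ, IsState ρ → IsState (Φ ρ))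
    (hΩΦ : ∀ τ, IsState τ → IsState (tensorMap Ω Φ τ)) :
    holevoCapacity Ω + holevoCapacity Φ ≤ holevoCapacity (tensorMap Ω Φ) := by
  have := nonempty_ensemble (n := m)
  have := nonempty_ensemble (n := n)
  have key : ∀ (E : Ensemble m) (F : Ensemble n),
      holevoQuantity Ω E + holevoQuantity Φ F ≤ holevoCapacity (tensorMap Ω Φ) := by
    intro E F
    have hE := E.prob_mem.2
    have hF := F.prob_mem.2
    have h := holevo_le_holevoCapacity hΩΦ (ι := Fin E.size × Fin F.size)
      (w := fun i => E.prob i.1 * F.prob i.2) (ρ := fun i => E.state i.1 ⊗ₖ F.state i.2)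
      ⟨fun i => mul_nonneg (E.prob_mem.1 _) (F.prob_mem.1 _), by
        rw [Fintype.sum_prod_type]
        simp only [← Finset.mul_sum, hF, mul_one, hE]⟩
      (fun i => isState_kronecker (E.isState _) (F.isState _))
    have hsum : ∑ i : Fin E.size × Fin F.size, ((E.prob i.1 * F.prob i.2 : ℝ) : ℂ) •
        tensorMap Ω Φ (E.state i.1 ⊗ₖ F.state i.2) =
        (∑ i, (E.prob i : ℂ) • Ω (E.state i)) ⊗ₖ (∑ j, (F.prob j : ℂ) • Φ (F.state j)) := by
      ext a b
      simp only [tensorMap_kronecker, Fintype.sum_prod_type, Matrix.sum_apply, Matrix.smul_apply,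
        kroneckerMap_apply, Finset.sum_mul_sum, smul_eq_mul, Complex.ofReal_mul]
      refine Finset.sum_congr rfl fun i _ => Finset.sum_congr rfl fun j _ => ?_
      ring
    have hent : ∑ i : Fin E.size × Fin F.size, E.prob i.1 * F.prob i.2 *
        entropy (tensorMap Ω Φ (E.state i.1 ⊗ₖ F.state i.2)) =
        ∑ i, E.prob i * entropy (Ω (E.state i)) + ∑ j, F.prob j * entropy (Φ (F.state j)) := by
      simp only [tensorMap_kronecker,
        entropy_kronecker (hΩ _ (E.isState _)) (hΦ _ (F.isState _)), Fintype.sum_prod_type, mul_add,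
        Finset.sum_add_distrib]
      congr 1
      · refine Finset.sum_congr rfl fun i _ => ?_
        rw [← Finset.sum_mul, ← Finset.mul_sum, hF, mul_one]
      · rw [Finset.sum_comm]
        refine Finset.sum_congr rfl fun i _ => ?_
        rw [← Finset.sum_mul, ← Finset.sum_mul, hE, one_mul]
    rw [hsum, hent, entropy_kronecker (isState_sum E.prob_mem fun i => hΩ _ (E.isState i))
      (isState_sum F.prob_mem fun i => hΦ _ (F.isState i))] at h
    simp only [holevoQuantity]
    linarith
  have h1 : ∀ F : Ensemble n,
      holevoCapacity Ω ≤ holevoCapacity (tensorMap Ω Φ) - holevoQuantity Φ F :=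
    fun F => ciSup_le fun E => by linarith [key E F]
  have h2 : holevoCapacity Φ ≤ holevoCapacity (tensorMap Ω Φ) - holevoCapacity Ω :=
    ciSup_le fun F => by linarith [h1 F]
  linarith

/-! ### The p-norm near p = 1 -/

theorem hasDerivAt_const_rpow_one {a : ℝ} (ha : 0 ≤ a) :
    HasDerivAt (fun p : ℝ => a ^ p) (-negMulLog a) 1 := by
  rcases ha.eq_or_lt with rfl | h
  · rw [negMulLog_zero, neg_zero]
    refine (hasDerivAt_const (1 : ℝ) (0 : ℝ)).congr_of_eventuallyEq ?_
    filter_upwards [lt_mem_nhds (zero_lt_one : (0 : ℝ) < 1)] with p hp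
    exact zero_rpow hp.ne'
  · have := (hasDerivAt_id (1 : ℝ)).const_rpow h
    simpa [negMulLog, mul_comm] using this

theorem hasDerivAt_one_div_one : HasDerivAt (fun p : ℝ => 1 / p) (-1) 1 := by
  simpa using hasDerivAt_inv (one_ne_zero (α := ℝ))

/-- The derivative of `p ↦ ‖A‖_p` at `p = 1`. -/
theorem hasDerivAt_lpNorm {A : Matrix n n ℂ} (hA : A.PosSemidef) :
    HasDerivAt (fun p => lpNorm p A) (negMulLog A.trace.re - entropy A) 1 := by
  obtain ⟨U, hU, d, hd, rfl⟩ := exists_unitary_diagonal hA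
  simp only [lpNorm_conj_diagonal hU hd, entropy_conj_diagonal hU, trace_conj_diagonal hU,
    Complex.ofReal_re]
  -- The zero matrix is separate: the derivative rule for real powers needs a nonzero base.
  rcases (Finset.sum_nonneg fun i _ => hd i : 0 ≤ ∑ i, d i).eq_or_lt with h | h
  · have h0 : ∀ i, d i = 0 := fun i =>
      (Finset.sum_eq_zero_iff_of_nonneg fun i _ => hd i).1 h.symm i (Finset.mem_univ i)
    simp only [h0, negMulLog_zero, Finset.sum_const_zero, sub_zero]
    refine (hasDerivAt_const (1 : ℝ) (0 : ℝ)).congr_of_eventuallyEq ?_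
    filter_upwards [lt_mem_nhds (zero_lt_one : (0 : ℝ) < 1)] with p hp
    simp [zero_rpow hp.ne', zero_rpow (inv_ne_zero hp.ne')]
  · have hsum : HasDerivAt (fun p : ℝ => ∑ i, d i ^ p) (∑ i, -negMulLog (d i)) 1 :=
      HasDerivAt.fun_sum fun i _ => hasDerivAt_const_rpow_one (hd i)
    have := hsum.rpow hasDerivAt_one_div_one (by simpa using h)
    convert this using 1
    simp only [rpow_one, div_one, sub_self, rpow_zero, Finset.sum_neg_distrib, negMulLog]
    ring

theorem lpNorm_one {A : Matrix n n ℂ} (hA : A.PosSemidef) : lpNorm 1 A = A.trace.re := by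
  obtain ⟨U, hU, d, hd, rfl⟩ := exists_unitary_diagonal hA
  simp [lpNorm_conj_diagonal hU hd, trace_conj_diagonal hU]

theorem lpNorm_nonneg {A : Matrix n n ℂ} (hA : A.PosSemidef) (p : ℝ) : 0 ≤ lpNorm p A := by
  obtain ⟨U, hU, d, hd, rfl⟩ := exists_unitary_diagonal hA
  rw [lpNorm_conj_diagonal hU hd]
  exact rpow_nonneg (Finset.sum_nonneg fun i _ => rpow_nonneg (hd i) p) _

/-- Multiply `exp v ≥ 1 + v` by the right side: `(1 + v)(1 - v + v²) = 1 + v³ ≥ 1`. -/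
theorem exp_neg_le {v : ℝ} (hv : 0 ≤ v) : Real.exp (-v) ≤ 1 - v + v ^ 2 := by
  rw [Real.exp_neg, inv_le_iff_one_le_mul₀ (Real.exp_pos v)]
  nlinarith [Real.add_one_le_exp v, pow_nonneg hv 3, sq_nonneg (v - 1)]

/-- A second-order expansion of `a ^ p` at `p = 1`, uniform in `a ∈ [0, 1]`. -/
theorem rpow_le_sub_negMulLog {a p : ℝ} (h0 : 0 ≤ a) (h1 : a ≤ 1) (hp : 1 ≤ p) :
    a ^ p ≤ a - (p - 1) * negMulLog a + 4 * (p - 1) ^ 2 := by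
  rcases h0.eq_or_lt with rfl | h
  · rw [zero_rpow (by linarith), negMulLog_zero]
    nlinarith [sq_nonneg (p - 1)]
  · have hlog : Real.log a ≤ 0 := Real.log_nonpos h0 h1
    have e := exp_neg_le (v := -((p - 1) * Real.log a)) (by nlinarith)
    have hap : a ^ p = a * Real.exp ((p - 1) * Real.log a) := by
      rw [mul_comm (p - 1), ← Real.rpow_def_of_pos h]
      nth_rewrite 2 [← Real.rpow_one a]
      rw [← Real.rpow_add h, add_sub_cancel]
    -- The constant 4 is the square of the bound `|√a log a| < 2`.
    have hb : a * Real.log a ^ 2 ≤ 4 := by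
      have hl := abs_log_mul_self_rpow_lt a (1 / 2) h h1 (by norm_num)
      rw [← sqrt_eq_rpow] at hl
      have h3 := sq_lt_sq' (by linarith [(abs_lt.1 hl).1]) (abs_lt.1 hl).2
      rw [mul_pow, Real.sq_sqrt h0] at h3
      linarith
    rw [neg_neg] at e
    rw [hap, negMulLog]
    nlinarith [mul_le_mul_of_nonneg_left e h0, mul_le_mul_of_nonneg_left hb (sq_nonneg (p - 1))]

/-- The bound depends on `ρ` only through `s` and the dimension, so it passes to the supremum `ν_p`,
which then need not be differentiated itself. -/
theorem lpNorm_le_of_le_entropy {ρ : Matrix n n ℂ} (hρ : IsState ρ) {s p : ℝ}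
    (hs : s ≤ entropy ρ) (hp : 1 ≤ p) :
    lpNorm p ρ ≤ (1 - (p - 1) * s + Fintype.card n * (4 * (p - 1) ^ 2)) ^ (1 / p) := by
  obtain ⟨U, hU, d, hd, rfl⟩ := exists_unitary_diagonal hρ.posSemidef
  have ht := hρ.trace_eq_one
  rw [trace_conj_diagonal hU] at ht
  replace ht : ∑ i, d i = 1 := by exact_mod_cast ht
  rw [entropy_conj_diagonal hU] at hs
  rw [lpNorm_conj_diagonal hU hd]
  refine rpow_le_rpow (Finset.sum_nonneg fun i _ => rpow_nonneg (hd i) p) ?_ (by positivity)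
  calc ∑ i, d i ^ p ≤ ∑ i, (d i - (p - 1) * negMulLog (d i) + 4 * (p - 1) ^ 2) :=
        Finset.sum_le_sum fun i _ => rpow_le_sub_negMulLog (hd i) (eigenvalue_le_one hd ht i) hp
    _ = 1 - (p - 1) * ∑ i, negMulLog (d i) + Fintype.card n * (4 * (p - 1) ^ 2) := by
        rw [Finset.sum_add_distrib, Finset.sum_sub_distrib, ht, ← Finset.mul_sum]
        simp
    _ ≤ _ := by nlinarith

theorem maxLpNorm_le_of_le_entropy [Nonempty n] {Φ : MatrixMap n}
    (hΦ : ∀ ρ, IsState ρ → IsState (Φ ρ)) {s p : ℝ}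
    (hs : ∀ ρ, IsState ρ → s ≤ entropy (Φ ρ)) (hp : 1 ≤ p) :
    maxLpNorm p Φ ≤ (1 - (p - 1) * s + Fintype.card n * (4 * (p - 1) ^ 2)) ^ (1 / p) := by
  obtain ⟨ρ, hρ⟩ := exists_isState (n := n)
  refine csSup_le ⟨_, ρ, hρ, rfl⟩ ?_
  rintro - ⟨σ, hσ, rfl⟩
  exact lpNorm_le_of_le_entropy (hΦ σ hσ) (hs σ hσ) hp

/-! ### From the norm inequality to an entropy inequality -/

theorem deriv_le_of_le_right {f g : ℝ → ℝ} {f' g' x b : ℝ} (hxb : x < b)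
    (hf : HasDerivAt f f' x) (hg : HasDerivAt g g' x) (hle : ∀ y ∈ Set.Ico x b, f y ≤ g y)
    (heq : f x = g x) : f' ≤ g' := by
  have h := ((hg.sub hf).hasDerivWithinAt (s := Set.Ioi x))
  rw [hasDerivWithinAt_iff_tendsto_slope' (by simp)] at h
  refine sub_nonneg.1 (ge_of_tendsto h ?_)
  filter_upwards [Ioo_mem_nhdsGT hxb] with y hy
  rw [slope_def_field]
  refine div_nonneg ?_ (sub_nonneg.2 hy.1.le)
  simp only [Pi.sub_apply, heq, sub_self, sub_zero, sub_nonneg]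
  exact hle y ⟨hy.1.le, hy.2⟩

/-- Differentiating the block inequality at `p = 1`. -/
theorem add_le_entropy_of_lpNorm_block_le {K : ℕ} {Φ : MatrixMap (Fin 2)} (hΦ : IsChannel Φ)
    {s : ℝ} (hs : 1 < s)
    (hbound : ∀ p ∈ Set.Ico (1 : ℝ) s, ∀ M : Matrix (Fin K × Fin 2) (Fin K × Fin 2) ℂ,
      M.PosSemidef →
      lpNorm p (tensorMap (LinearMap.id : MatrixMap (Fin K)) Φ M) ≤
        maxLpNorm p Φ * (lpNorm p (block M 0 0) + lpNorm p (block M 1 1)))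
    {S : ℝ} (hS : ∀ ρ, IsState ρ → S ≤ entropy (Φ ρ))
    {M : Matrix (Fin K × Fin 2) (Fin K × Fin 2) ℂ} (hM : IsState M) :
    S + (entropy (block M 0 0) - negMulLog (block M 0 0).trace.re) +
        (entropy (block M 1 1) - negMulLog (block M 1 1).trace.re) ≤
      entropy (tensorMap (LinearMap.id : MatrixMap (Fin K)) Φ M) := by
  have hX := posSemidef_block hM.posSemidef 0
  have hZ := posSemidef_block hM.posSemidef 1
  have hN : IsState (tensorMap (LinearMap.id : MatrixMap (Fin K)) Φ M) :=
    ⟨hΦ.completelyPositive K M hM.posSemidef, by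
      rw [trace_tensorMap (fun _ => rfl) hΦ.tracePreserving, hM.trace_eq_one]⟩
  have hsum : (block M 0 0).trace.re + (block M 1 1).trace.re = 1 := by
    rw [← Complex.add_re, trace_block_add, hM.trace_eq_one, Complex.one_re]
  -- This function to the power `1 / p` majorizes `ν_p`; it equals 1 at `p = 1`, and its quadratic
  -- error does not affect the derivative `-S`.
  have hu : HasDerivAt (fun p : ℝ => 1 - (p - 1) * S + Fintype.card (Fin 2) * (4 * (p - 1) ^ 2))
      (-S) 1 := by
    have h1 := (hasDerivAt_id (1 : ℝ)).sub_const 1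
    have h2 := ((h1.mul_const S).const_sub 1).fun_add
      (((h1.pow 2).const_mul 4).const_mul (Fintype.card (Fin 2) : ℝ))
    simpa using h2
  have hν := hu.rpow hasDerivAt_one_div_one (by simp)
  have hG := hν.mul ((hasDerivAt_lpNorm hX).add (hasDerivAt_lpNorm hZ))
  -- Derivatives can be compared because both sides equal 1 at `p = 1`: the output has trace 1 and
  -- the block traces add to 1.
  have hle := deriv_le_of_le_right hs (hasDerivAt_lpNorm hN.posSemidef) hG
    (fun p hp => (hbound p hp M hM.posSemidef).trans (mul_le_mul_of_nonneg_right
      (maxLpNorm_le_of_le_entropy (fun ρ hρ => hΦ.isState hρ) hS hp.1)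
      (add_nonneg (lpNorm_nonneg hX p) (lpNorm_nonneg hZ p))))
    (by simp [lpNorm_one hN.posSemidef, hN.trace_eq_one, lpNorm_one hX, lpNorm_one hZ, hsum])
  simp [hN.trace_eq_one, lpNorm_one hX, lpNorm_one hZ, hsum] at hle
  linarith

/-! ### Additivity of the capacity -/

/-- Test the capacity on `ρ` and `1 - ρ` with equal weights: by unitality the outputs are antipodal,
with equal entropies and average `I / 2`. -/
theorem log_two_sub_entropy_le_holevoCapacity {Φ : MatrixMap (Fin 2)} (hΦ : IsChannel Φ)
    (hunital : Φ 1 = 1) {ρ : Matrix (Fin 2) (Fin 2) ℂ} (hρ : IsState ρ) :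
    Real.log 2 - entropy (Φ ρ) ≤ holevoCapacity Φ := by
  have h := holevo_le_holevoCapacity (fun ρ hρ => hΦ.isState hρ) (w := fun _ : Fin 2 => 1 / 2)
    (ρ := ![ρ, 1 - ρ]) ⟨fun _ => by norm_num, by norm_num⟩ (by
      intro i
      fin_cases i
      exacts [hρ, isState_one_sub hρ])
  have h1 : ((1 / 2 : ℝ) : ℂ) • Φ ρ + ((1 / 2 : ℝ) : ℂ) • (1 - Φ ρ) = (1 / 2 : ℂ) • 1 := by
    rw [← smul_add, add_sub_cancel]
    push_cast
    rfl
  simp only [Fin.sum_univ_two, cons_val_zero, cons_val_one, map_sub, hunital, h1, entropy_half_one,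
    entropy_one_sub (hΦ.isState hρ)] at h
  linarith

/-- Subadditivity of the Holevo capacity for a unital qubit channel satisfying the block
inequality. -/
theorem holevoCapacity_tensorMap_le {K : ℕ} [NeZero K] {Φ : MatrixMap (Fin 2)} (hΦ : IsChannel Φ)
    (hunital : Φ 1 = 1) {s : ℝ} (hs : 1 < s)
    (hbound : ∀ p ∈ Set.Ico (1 : ℝ) s, ∀ M : Matrix (Fin K × Fin 2) (Fin K × Fin 2) ℂ,
      M.PosSemidef →
      lpNorm p (tensorMap (LinearMap.id : MatrixMap (Fin K)) Φ M) ≤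
        maxLpNorm p Φ * (lpNorm p (block M 0 0) + lpNorm p (block M 1 1)))
    {Ω : MatrixMap (Fin K)} (hΩ : IsChannel Ω) :
    holevoCapacity (tensorMap Ω Φ) ≤ holevoCapacity Ω + holevoCapacity Φ := by
  -- `ciSup_le` needs an ensemble to exist, hence `K > 0`.
  have := nonempty_ensemble (n := Fin K × Fin 2)
  refine ciSup_le fun E => ?_
  have hout : ∀ τ, IsState τ →
      Real.log 2 - holevoCapacity Φ +
        ∑ a, (entropy (Ω (block τ a a)) - negMulLog (block τ a a).trace.re) ≤
      entropy (tensorMap Ω Φ τ) := by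
    intro τ hτ
    have hM : IsState (tensorMap Ω (LinearMap.id : MatrixMap (Fin 2)) τ) :=
      ⟨hΩ.completelyPositive.tensorMap_id hτ.posSemidef, by
        rw [trace_tensorMap hΩ.tracePreserving fun _ => rfl, hτ.trace_eq_one]⟩
    have h := add_le_entropy_of_lpNorm_block_le hΦ hs hbound
      (S := Real.log 2 - holevoCapacity Φ)
      (fun ρ hρ => by linarith [log_two_sub_entropy_le_holevoCapacity hΦ hunital hρ]) hM
    simp only [tensorMap_id_left_tensorMap_id_right, block_tensorMap_id, hΩ.tracePreserving] at h
    rw [Fin.sum_univ_two]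
    linarith
  have havg := isState_sum E.prob_mem E.isState
  set τ := ∑ i, (E.prob i : ℂ) • E.state i with hτ
  have hsub := entropy_le_entropy_partialTrace_add_log_two (hΩ.isState_tensorMap hΦ havg)
  rw [partialTrace_tensorMap Ω hΦ.tracePreserving] at hsub
  -- Test ensemble for `Ω`: both diagonal blocks of every state, unnormalized, the traces serving as
  -- probabilities.
  let T : Fin E.size × Fin 2 → Matrix (Fin K) (Fin K) ℂ :=
    fun i => (E.prob i.1 : ℂ) • block (E.state i.1) i.2 i.2
  have hT : ∀ i, (T i).PosSemidef := fun i =>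
    (posSemidef_block (E.isState i.1).posSemidef i.2).smul
      (Complex.zero_le_real.2 (E.prob_mem.1 i.1))
  have hblock : ∀ i, ∑ a, (block (E.state i) a a).trace.re = 1 := fun i => by
    rw [Fin.sum_univ_two, ← Complex.add_re, trace_block_add, (E.isState i).trace_eq_one,
      Complex.one_re]
  have htrT : ∀ i, (T i).trace.re = E.prob i.1 * (block (E.state i.1) i.2 i.2).trace.re :=
    fun i => by simp [T, trace_smul]
  have htr : ∑ i, (T i).trace.re = 1 := by
    simp only [htrT, Fintype.sum_prod_type, ← Finset.mul_sum, hblock, mul_one, E.prob_mem.2]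
  have hcap := holevo_le_holevoCapacity_of_posSemidef (fun ρ hρ => hΩ.isState hρ) hT htr
  have hsumT : ∑ i, T i = block τ 0 0 + block τ 1 1 := by
    have hb : ∀ a, block τ a a = ∑ i, (E.prob i : ℂ) • block (E.state i) a a := fun a => by
      change blockLinearMap a a τ = _
      rw [hτ, map_sum]
      simp only [map_smul]
      rfl
    rw [hb, hb, ← Finset.sum_add_distrib, Fintype.sum_prod_type]
    simp [T, Fin.sum_univ_two]
  have hentT : ∀ i, entropy (Ω (T i)) - negMulLog (T i).trace.re =
      E.prob i.1 * (entropy (Ω (block (E.state i.1) i.2 i.2)) -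
        negMulLog (block (E.state i.1) i.2 i.2).trace.re) := fun i => by
    rw [htrT, negMulLog_mul, map_smul, entropy_smul (hΩ.completelyPositive.posSemidef
      (posSemidef_block (E.isState i.1).posSemidef i.2)), hΩ.tracePreserving]
    ring
  rw [hsumT] at hcap
  simp only [hentT, Fintype.sum_prod_type, ← Finset.mul_sum] at hcap
  have hmean : Real.log 2 - holevoCapacity Φ +
      ∑ i, E.prob i * ∑ a, (entropy (Ω (block (E.state i) a a)) -
        negMulLog (block (E.state i) a a).trace.re) ≤
      ∑ i, E.prob i * entropy (tensorMap Ω Φ (E.state i)) := by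
    calc _ = ∑ i, E.prob i * (Real.log 2 - holevoCapacity Φ +
          ∑ a, (entropy (Ω (block (E.state i) a a)) -
            negMulLog (block (E.state i) a a).trace.re)) := by
          simp only [mul_add, Finset.sum_add_distrib, ← Finset.sum_mul, E.prob_mem.2, one_mul]
      _ ≤ _ := Finset.sum_le_sum fun i _ =>
          mul_le_mul_of_nonneg_left (hout _ (E.isState i)) (E.prob_mem.1 i)
  have hlin : ∑ i, (E.prob i : ℂ) • tensorMap Ω Φ (E.state i) = tensorMap Ω Φ τ := by
    simp [hτ]
  rw [holevoQuantity, hlin]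
  -- `hsub` bounds the average output, `hmean` the mean entropy and `hcap` their difference through
  -- `Ω`; `log 2` cancels.
  linarith

end QubitChannel

end

theorem corollary3 (K : ℕ) (hK : 0 < K)
    (Φ : QubitChannel.MatrixMap (Fin 2)) (hΦ : QubitChannel.IsChannel Φ) (hunital : Φ 1 = 1)
    (s : ℝ) (hs : 1 < s)
    (hbound : ∀ p ∈ Set.Ico (1 : ℝ) s, ∀ M : Matrix (Fin K × Fin 2) (Fin K × Fin 2) ℂ,
      M.PosSemidef →
      QubitChannel.lpNorm p
          (QubitChannel.tensorMap (LinearMap.id : QubitChannel.MatrixMap (Fin K)) Φ M) ≤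
        QubitChannel.maxLpNorm p Φ *
          (QubitChannel.lpNorm p (QubitChannel.block M 0 0) +
            QubitChannel.lpNorm p (QubitChannel.block M 1 1)))
    (Ω : QubitChannel.MatrixMap (Fin K)) (hΩ : QubitChannel.IsChannel Ω) :
    QubitChannel.holevoCapacity (QubitChannel.tensorMap Ω Φ) =
      QubitChannel.holevoCapacity Ω + QubitChannel.holevoCapacity Φ := by
  have : NeZero K := ⟨hK.ne'⟩
  exact le_antisymm (QubitChannel.holevoCapacity_tensorMap_le hΦ hunital hs hbound hΩ)
    (QubitChannel.holevoCapacity_add_le (fun _ hρ => hΩ.isState hρ) (fun _ hρ => hΦ.isState hρ)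
      fun _ hτ => hΩ.isState_tensorMap hΦ hτ)
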